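/- Let $k,n\ge 0$ be integers and let $(M,\omega_0^1,\dots,\omega_0^k,V)$ be a $k$-symplectic manifold: $M$ is a smooth manifold of dimension $n+kn$, the $\omega_0^A$ are smooth closed $2$-forms on $M$ with $\bigcap_{A=1}^k\ker\omega_0^A=\{0\}$, and $V$ is an integrable tangent distribution of rank $nk$ on $M$ with $\omega_0^A|_{V\times V}=0$ for all $A$. On $\mathbb R^k\times M$, with projections $\pi_{\mathbb R^k}$ and $\pi_M$ and with $(t^1,\dots,t^k)$ the coordinates of $\mathbb R^k$, put $\eta^A=\pi_{\mathbb R^k}^*dt^A$ and $\omega^A=\pi_M^*\omega_0^A$ for $1\le A\le k$, and let $H\in C^\infty(\mathbb R^k\times M)$. Write $i(Y)$ for the interior product and $L(Y)$ for the Lie derivative. Let $Y$ be an infinitesimal $k$-cosymplectic Noether symmetry of $(\mathbb R^k\times M,H)$, that is, a smooth vector field on $\mathbb R^k\times M$ such that, for all $A$, $$L(Y)\omega^A=0,\qquad i(Y)\eta^A=0,\qquad L(Y)H=0 .$$ Then every $p\in\mathbb R^k\times M$ has an open neighbourhood $U_p$ with the following two properties. 1. For every $A$ there is a function $F^A\in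 C^\infty(U_p)$ with $$i(Y)\omega^A=dF^A\quad\text{on }U_p,$$ and any two such functions differ by a constant on $U_p$. 2. Let $\theta^1,\dots,\theta^k$ be any smooth $1$-forms on $\mathbb R^k\times M$ with $\omega^A=-d\theta^A$ for all $A$ (if such forms exist). Then for every $A$ there is a function $\zeta^A\in C^\infty(U_p)$ with $L(Y)\theta^A=d\zeta^A$ on $U_p$. Moreover, for every such $\zeta^A$ and every $F^A\in C^\infty(U_p)$ with $i(Y)\omega^A=dF^A$ on $U_p$, the function $$F^A-\bigl(i(Y)\theta^A-\zeta^A\bigr)$$ is constant on $U_p$. -/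

import Mathlib

open scoped Manifold ContDiff Topology

noncomputable section

namespace KCosymplectic

section Forms

variable {E : Type*} [NormedAddCommGroup E] [NormedSpace ℝ E]
  {H : Type*} [TopologicalSpace H] (I : ModelWithCorners ℝ E H)
  {E' : Type*} [NormedAddCommGroup E'] [NormedSpace ℝ E']
  {H' : Type*} [TopologicalSpace H'] (I' : ModelWithCorners ℝ E' H')

/-- A (not necessarily smooth) differential `n`-form on a manifold `M`. -/
abbrev Form (M : Type*) [TopologicalSpace M] [ChartedSpace H M] (n : ℕ) :=
  (x : M) → (TangentSpace I x) [⋀^Fin n]→L[ℝ] ℝ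

variable {M : Type*} [TopologicalSpace M] [ChartedSpace H M]
  {M' : Type*} [TopologicalSpace M'] [ChartedSpace H' M'] {n : ℕ}

/-- The local expression of a form in the preferred chart `φ` at `x₀`, that is, the pullback of the
form by `φ⁻¹`. It is meaningful on the target of `φ`. -/
def formInChart (α : Form I M n) (x₀ : M) (e : E) : E [⋀^Fin n]→L[ℝ] ℝ :=
  (α ((extChartAt I x₀).symm e)).compContinuousLinearMap
    (mfderivWithin 𝓘(ℝ, E) I (extChartAt I x₀).symm (Set.range I) e)

/-- A form is smooth if all its local expressions are smooth. -/
def IsSmoothForm (α : Form I M n) : Prop :=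
  ∀ x₀ : M, ContDiffOn ℝ ∞ (formInChart I α x₀) (extChartAt I x₀).target

/-- The pullback `f^* α` of a form. -/
def formPullback (f : M → M') (α : Form I' M' n) : Form I M n :=
  fun x ↦ (α (f x)).compContinuousLinearMap (mfderiv I I' f x)

/-- The exterior derivative `d α`, computed in the preferred chart at each point. -/
def extD (α : Form I M n) : Form I M (n + 1) :=
  fun x ↦ (extDerivWithin (formInChart I α x) (Set.range I)
    (extChartAt I x x)).compContinuousLinearMap (mfderiv I 𝓘(ℝ, E) (extChartAt I x) x)

/-- The differential `d f` of a function, as a `1`-form. -/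
def differential (f : M → ℝ) : Form I M 1 :=
  fun x ↦ ContinuousAlternatingMap.ofSubsingleton ℝ (TangentSpace I x) ℝ (0 : Fin 1)
    (mvfderiv I f x)

/-- The interior product `i(Y) α`, that is, `(v₁, …, vₙ) ↦ α (Y, v₁, …, vₙ)`. -/
def interiorProduct (Y : (x : M) → TangentSpace I x) (α : Form I M (n + 1)) : Form I M n :=
  fun x ↦
    { (α x).toAlternatingMap.curryLeft (Y x) with
      cont := (α x).cont.comp (continuous_const.matrixVecCons continuous_id) }

/-- The interior product `i(Y) θ = θ(Y)` for a `1`-form `θ`, as a function. -/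
def contract (Y : (x : M) → TangentSpace I x) (θ : Form I M 1) : M → ℝ :=
  fun x ↦ θ x ![Y x]

/-- The Lie derivative along `Y` of a form on a set `s` in a vector space:
`(L(Y) α)(v₁, …, vₙ) = (D_Y α)(v₁, …, vₙ) + ∑ᵢ α(v₁, …, D_{vᵢ} Y, …, vₙ)`. -/
def lieDerivWithin (Y : E → E) (α : E → E [⋀^Fin n]→L[ℝ] ℝ) (s : Set E) (e : E) :
    E [⋀^Fin n]→L[ℝ] ℝ :=
  fderivWithin ℝ α s e (Y e) +
    (α e).fderivCompContinuousLinearMap (ContinuousLinearMap.id ℝ E) (fderivWithin ℝ Y s e)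

/-- The Lie derivative `L(Y) α`, computed in the preferred chart at each point. -/
def lieDerivForm (Y : (x : M) → TangentSpace I x) (α : Form I M n) : Form I M n :=
  fun x ↦ (lieDerivWithin
    (VectorField.mpullbackWithin 𝓘(ℝ, E) I (extChartAt I x).symm Y (Set.range I))
    (formInChart I α x) (Set.range I) (extChartAt I x x)).compContinuousLinearMap
      (mfderiv I 𝓘(ℝ, E) (extChartAt I x) x)

/-- The Lie derivative `L(Y) f = Y(f)` of a function. -/
def lieDerivFun (Y : (x : M) → TangentSpace I x) (f : M → ℝ) : M → ℝ :=
  fun x ↦ mvfderiv I f x (Y x)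

/-- `f` is a smooth function on the set `U` such that `d f = α` on `U`. For open `U` this depends
only on the restriction of `f` to `U`. -/
def IsPrimitiveOn (α : Form I M 1) (U : Set M) (f : M → ℝ) : Prop :=
  ContMDiffOn I 𝓘(ℝ, ℝ) ∞ f U ∧ ∀ x ∈ U, α x = differential I f x

/-- `V` is an integrable distribution on `M`: around each point there is a smooth chart `φ`, with
values in `E`, in which `V` is the constant distribution given by a linear subspace `W` of `E`. -/
def IsIntegrableDistribution (V : (x : M) → Submodule ℝ (TangentSpace I x)) : Prop :=
  ∀ p : M, ∃ φ ∈ IsManifold.maximalAtlas I ∞ M, p ∈ φ.source ∧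
    ∃ W : Submodule ℝ E, ∀ x ∈ φ.source, ∀ v : TangentSpace I x,
      v ∈ V x ↔ (mfderiv I 𝓘(ℝ, E) (φ.extend I) x v : E) ∈ W

end Forms

section Structures

variable {E : Type*} [NormedAddCommGroup E] [NormedSpace ℝ E]
  {H : Type*} [TopologicalSpace H] (I : ModelWithCorners ℝ E H)
  (M : Type*) [TopologicalSpace M] [ChartedSpace H M] (k n : ℕ)

/-- A `k`-symplectic structure `(ω₀¹, …, ω₀ᵏ, V)` on a manifold `M` of dimension `n + k n`. -/
structure KSymplecticStructure where
  /-- the `2`-forms `ω₀ᴬ` -/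
  form : Fin k → Form I M 2
  /-- the distribution `V` -/
  dist : (x : M) → Submodule ℝ (TangentSpace I x)
  finrank_model : Module.finrank ℝ E = n + k * n
  smooth : ∀ A, IsSmoothForm I (form A)
  closed : ∀ A, extD I (form A) = 0
  nondegenerate : ∀ (x : M) (v : TangentSpace I x),
    (∀ A, ∀ w : TangentSpace I x, form A x ![v, w] = 0) → v = 0
  finrank_dist : ∀ x, Module.finrank ℝ (dist x) = n * k
  integrable : IsIntegrableDistribution I dist
  isotropic : ∀ (A : Fin k) (x : M), ∀ v ∈ dist x, ∀ w ∈ dist x, form A x ![v, w] = 0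

/-- The manifold `ℝᵏ × M`. -/
abbrev Phase := EuclideanSpace ℝ (Fin k) × M

/-- The model of the manifold `ℝᵏ × M`. -/
abbrev phaseModel : ModelWithCorners ℝ (EuclideanSpace ℝ (Fin k) × E)
    (ModelProd (EuclideanSpace ℝ (Fin k)) H) :=
  𝓘(ℝ, EuclideanSpace ℝ (Fin k)).prod I

variable {k}

/-- The `1`-form `ηᴬ = π^* dtᴬ` on `ℝᵏ × M`, where `π : ℝᵏ × M → ℝᵏ` is the projection. -/
def eta (A : Fin k) : Form (phaseModel I k) (Phase M k) 1 :=
  formPullback (phaseModel I k) 𝓘(ℝ, EuclideanSpace ℝ (Fin k)) Prod.fst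
    (differential 𝓘(ℝ, EuclideanSpace ℝ (Fin k)) (fun t : EuclideanSpace ℝ (Fin k) ↦ t A))

variable {I M n}

/-- The `2`-form `ωᴬ = π_M^* ω₀ᴬ` on `ℝᵏ × M`, where `π_M : ℝᵏ × M → M` is the projection. -/
def KSymplecticStructure.omega (S : KSymplecticStructure I M k n) (A : Fin k) :
    Form (phaseModel I k) (Phase M k) 2 :=
  formPullback (phaseModel I k) I Prod.snd (S.form A)

/-- `Y` is an infinitesimal `k`-cosymplectic Noether symmetry of the `k`-cosymplectic Hamiltonian
system `(ℝᵏ × M, h)`. -/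
structure IsInfinitesimalNoetherSymmetry [IsManifold I ∞ M] (S : KSymplecticStructure I M k n)
    (h : Phase M k → ℝ) (Y : (x : Phase M k) → TangentSpace (phaseModel I k) x) : Prop where
  smooth : ContMDiff (phaseModel I k) (phaseModel I k).tangent ∞
    (fun x ↦ (⟨x, Y x⟩ : TangentBundle (phaseModel I k) (Phase M k)))
  lieDeriv_omega : ∀ A, lieDerivForm (phaseModel I k) Y (S.omega A) = 0
  interior_eta : ∀ A, contract (phaseModel I k) Y (eta I M A) = 0
  lieDeriv_hamiltonian : lieDerivFun (phaseModel I k) Y h = 0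

end Structures

end KCosymplectic

end

open KCosymplectic

/-!
The statement follows from Cartan's formula `L(Y) α = i(Y) dα + d i(Y) α` and the Poincaré lemma.

The form `ω = π_M^* ω₀` is closed because the exterior derivative commutes with pullbacks
(`extD_formPullback`). Hence `0 = L(Y) ω = d i(Y) ω`, and the closed `1`-form `i(Y) ω` has a
primitive on the preimage `U` of a ball in a chart (`exists_isOpen_forall_exists_isPrimitiveOn`).
Two primitives on `U` differ by a constant, since `U` is connected. If `ω = -dθ`, then Cartan's
formula for `θ` reads `L(Y) θ = -i(Y) ω + d (i(Y) θ)`, so that `ζ` is a primitive of `L(Y) θ` on `U`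
if and only if `i(Y) θ - ζ` is a primitive of `i(Y) ω` there.

The forms and operators on manifolds are defined through the preferred chart at each point.
Cartan's formula is an identity at a point, so it reduces to the formula on a vector space
(`lieDerivWithin_univ_eq`) in the preferred chart at that point. For the Poincaré lemma one chart
has to serve for all points of `U`, so that the exterior derivative has to be independent of the
chart (`extD_eq_of_mem_source`); this is the case `f = id` of the computation of `d (f^* α)` in an
arbitrary chart of the target (`extD_formPullback_eq`).
-/

/-! ### Forms on vector spaces -/

section VectorSpace

variable {E : Type*} [NormedAddCommGroup E] [NormedSpace ℝ E]
  {X : Type*} [NormedAddCommGroup X] [NormedSpace ℝ X] {n : ℕ} {r : WithTop ℕ∞}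

variable (E n) in
/-- `ContinuousAlternatingMap.curryLeft`, which sends `α` to `w ↦ i(w) α`, as a continuous linear
map. -/
noncomputable def curryLeftCLM : (E [⋀^Fin (n + 1)]→L[ℝ] ℝ) →L[ℝ] E →L[ℝ] E [⋀^Fin n]→L[ℝ] ℝ :=
  (ContinuousAlternatingMap.curryLeftLI (𝕜 := ℝ) (E := E) (F := ℝ)
    (n := n)).toContinuousLinearMap

lemma curryLeftCLM_apply (α : E [⋀^Fin (n + 1)]→L[ℝ] ℝ) : curryLeftCLM E n α = α.curryLeft := rfl

lemma ContDiffOn.curryLeft_apply {α : X → E [⋀^Fin (n + 1)]→L[ℝ] ℝ} {Y : X → E} {s : Set X}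
    (hα : ContDiffOn ℝ r α s) (hY : ContDiffOn ℝ r Y s) :
    ContDiffOn ℝ r (fun y ↦ (α y).curryLeft (Y y)) s := by
  have h : ContDiff ℝ r (curryLeftCLM E n) := ContinuousLinearMap.contDiff _
  exact (h.comp_contDiffOn hα).clm_apply hY

/-- Since a form is, up to a factor, the alternatization of its contractions with fixed vectors,
smoothness of a pullback follows by induction on the degree. -/
lemma ContDiffOn.continuousAlternatingMap_compContinuousLinearMap {F : Type*}
    [NormedAddCommGroup F] [NormedSpace ℝ F] [FiniteDimensional ℝ E]
    {α : X → F [⋀^Fin n]→L[ℝ] ℝ} {g : X → E →L[ℝ] F} {s : Set X}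
    (hα : ContDiffOn ℝ r α s) (hg : ContDiffOn ℝ r g s) :
    ContDiffOn ℝ r (fun y ↦ (α y).compContinuousLinearMap (g y)) s := by
  induction n with
  | zero =>
    have h : (fun y ↦ (α y).compContinuousLinearMap (g y)) = fun y ↦
        ContinuousAlternatingMap.constOfIsEmptyLIE ℝ E ℝ (Fin 0)
          ((ContinuousAlternatingMap.constOfIsEmptyLIE ℝ F ℝ (Fin 0)).symm (α y)) := by
      ext y v
      simp [Subsingleton.elim (g y ∘ v) 0]
    rw [h]
    exact (ContinuousAlternatingMap.constOfIsEmptyLIE ℝ E ℝ (Fin 0)).contDiff.comp_contDiffOn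
      ((ContinuousAlternatingMap.constOfIsEmptyLIE ℝ F ℝ
        (Fin 0)).symm.contDiff.comp_contDiffOn hα)
  | succ n ih =>
    have h : (fun y ↦ (α y).compContinuousLinearMap (g y)) = fun y ↦ ((n : ℝ) + 1)⁻¹ •
        ContinuousAlternatingMap.alternatizeUncurryFinCLM ℝ E ℝ
          ((α y).compContinuousLinearMap (g y)).curryLeft := by
      ext1 y
      rw [ContinuousAlternatingMap.alternatizeUncurryFinCLM_apply,
        ContinuousAlternatingMap.alternatizeUncurryFin_curryLeft]
      ext v
      simp
      field_simp
    rw [h]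
    have hc : ContDiffOn ℝ r (fun y ↦ ((α y).compContinuousLinearMap (g y)).curryLeft) s := by
      refine contDiffOn_clm_apply.2 fun w ↦ ?_
      simp only [ContinuousAlternatingMap.curryLeft_compContinuousLinearMap]
      exact ih (hα.curryLeft_apply (hg.clm_apply contDiffOn_const))
    have ha : ContDiff ℝ r (ContinuousAlternatingMap.alternatizeUncurryFinCLM ℝ E ℝ (n := n)) :=
      ContinuousLinearMap.contDiff _
    exact (ha.comp_contDiffOn hc).const_smul ((n : ℝ) + 1)⁻¹

/-- **Cartan's formula** `L(Y) α = i(Y) dα + d i(Y) α` on a vector space. -/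
lemma lieDerivWithin_univ_eq {Y : E → E} {α : E → E [⋀^Fin (n + 1)]→L[ℝ] ℝ} {e : E}
    (hα : DifferentiableAt ℝ α e) (hY : DifferentiableAt ℝ Y e) :
    lieDerivWithin Y α Set.univ e =
      (extDeriv α e).curryLeft (Y e) + extDeriv (fun x ↦ (α x).curryLeft (Y x)) e := by
  have hβ : fderiv ℝ (fun x ↦ (α x).curryLeft (Y x)) e =
      (α e).curryLeft ∘L fderiv ℝ Y e + (curryLeftCLM E n ∘L fderiv ℝ α e).flip (Y e) := by
    have h : HasFDerivAt (curryLeftCLM E n) (curryLeftCLM E n) (α e) :=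
      ContinuousLinearMap.hasFDerivAt _
    have h' : HasFDerivAt (fun x ↦ (α x).curryLeft) (curryLeftCLM E n ∘L fderiv ℝ α e) e :=
      HasFDerivAt.comp (g := curryLeftCLM E n) (G := E →L[ℝ] E [⋀^Fin n]→L[ℝ] ℝ) e
        h hα.hasFDerivAt
    exact (h'.clm_apply hY.hasFDerivAt).fderiv
  ext v
  -- moving `D_{vᵢ} Y` from the `i`-th slot to the front costs the sign of the exterior derivative
  have h (i : Fin (n + 1)) : (α e) (fun j ↦ Function.update
      (fun _ ↦ ContinuousLinearMap.id ℝ E) i (fderiv ℝ Y e) j (v j)) =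
        (-1) ^ (i : ℕ) • (α e) (Matrix.vecCons (fderiv ℝ Y e (v i)) (i.removeNth v)) := by
    rw [← ContinuousAlternatingMap.map_insertNth]
    congr 1
    ext j
    rcases Fin.eq_self_or_eq_succAbove i j with rfl | ⟨j, rfl⟩
    · simp
    · simp [Fin.removeNth]
  have h' (i : Fin (n + 1)) : i.succ.removeNth (Matrix.vecCons (Y e) v) =
      Matrix.vecCons (Y e) (i.removeNth v) := by
    ext j
    refine Fin.cases ?_ (fun j ↦ ?_) j <;> simp [Fin.removeNth]
  have h0 : (0 : Fin (n + 2)).removeNth (Matrix.vecCons (Y e) v) = v := by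
    ext j
    simp [Fin.removeNth]
  simp only [lieDerivWithin, fderivWithin_univ, extDeriv, hβ,
    ContinuousAlternatingMap.add_apply, ContinuousAlternatingMap.curryLeft_apply_apply,
    ContinuousAlternatingMap.fderivCompContinuousLinearMap_apply, h,
    ContinuousAlternatingMap.alternatizeUncurryFin_apply]
  -- the term of `dα (Y, v)` that differentiates along `Y` is `D_Y α`, and the remaining ones cancel
  -- those terms of `d i(Y) α` in which `α` is differentiated
  rw [Fin.sum_univ_succ (n := n + 1)]
  simp only [h', h0, Fin.val_zero, Fin.val_succ, pow_zero, one_smul, Matrix.cons_val_zero,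
    Matrix.cons_val_succ, add_apply, ContinuousAlternatingMap.add_apply,
    ContinuousLinearMap.comp_apply, ContinuousLinearMap.flip_apply, curryLeftCLM_apply,
    ContinuousAlternatingMap.curryLeft_apply_apply, smul_add, Finset.sum_add_distrib, pow_succ,
    mul_neg, mul_one, neg_smul, Finset.sum_neg_distrib]
  abel

end VectorSpace

/-! ### Pullbacks and the exterior derivative on manifolds -/

namespace KCosymplectic

section Manifold

variable {E : Type*} [NormedAddCommGroup E] [NormedSpace ℝ E]
  {H : Type*} [TopologicalSpace H] {I : ModelWithCorners ℝ E H}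
  {M : Type*} [TopologicalSpace M] [ChartedSpace H M] [IsManifold I ∞ M]
  {E' : Type*} [NormedAddCommGroup E'] [NormedSpace ℝ E']
  {H' : Type*} [TopologicalSpace H'] {I' : ModelWithCorners ℝ E' H'}
  {M' : Type*} [TopologicalSpace M'] [ChartedSpace H' M'] [IsManifold I' ∞ M']
  {n : ℕ}

/-- A form is the pullback by a chart of its local expression in this chart. -/
lemma form_eq_formInChart (α : Form I M n) {x₀ x : M} (hx : x ∈ (extChartAt I x₀).source) :
    α x = (formInChart I α x₀ (extChartAt I x₀ x)).compContinuousLinearMap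
      (mfderiv I 𝓘(ℝ, E) (extChartAt I x₀) x) := by
  have : IsManifold I 1 M := .of_le (n := ∞) (by simp)
  have h := mfderivWithin_extChartAt_symm_comp_mfderiv_extChartAt' hx
  ext v
  -- all tangent spaces are `E` by definition: forget the base point, to be able to rewrite it
  let α' : M → E [⋀^Fin n]→L[ℝ] ℝ := α
  change α' x v = α' ((extChartAt I x₀).symm (extChartAt I x₀ x)) (fun i ↦ _)
  rw [(extChartAt I x₀).left_inv hx]
  congr 1
  ext i
  exact (DFunLike.congr_fun h (v i)).symm

omit [IsManifold I ∞ M] in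
lemma contDiffAt_formInChart [I.Boundaryless] {α : Form I M n} (hα : IsSmoothForm I α)
    {x₀ : M} {e : E} (he : e ∈ (extChartAt I x₀).target) : ContDiffAt ℝ ∞ (formInChart I α x₀) e :=
  (hα x₀).contDiffAt ((isOpen_extChartAt_target x₀).mem_nhds he)

lemma contMDiffAt_extChartAt_symm [I.Boundaryless] {x₀ : M} {e : E}
    (he : e ∈ (extChartAt I x₀).target) :
    ContMDiffAt 𝓘(ℝ, E) I ∞ (extChartAt I x₀).symm e :=
  (contMDiffOn_extChartAt_symm x₀).contMDiffAt ((isOpen_extChartAt_target x₀).mem_nhds he)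

section Pullback

variable [I.Boundaryless] {f : M → M'} (hf : ContMDiff I I' ∞ f)
include hf

lemma contDiffAt_writtenInCharts {x₀ : M} {y₀ : M'} {e : E} (he : e ∈ (extChartAt I x₀).target)
    (hy : f ((extChartAt I x₀).symm e) ∈ (extChartAt I' y₀).source) :
    ContDiffAt ℝ ∞ (fun z ↦ extChartAt I' y₀ (f ((extChartAt I x₀).symm z))) e := by
  rw [← contMDiffAt_iff_contDiffAt]
  have h1 : ContMDiffAt I' 𝓘(ℝ, E') ∞ (extChartAt I' y₀) (f ((extChartAt I x₀).symm e)) :=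
    contMDiffAt_extChartAt' (by simpa using hy)
  exact h1.comp e ((hf _).comp e (contMDiffAt_extChartAt_symm he))

/-- In charts, the pullback of a form along `f` is the pullback along the expression of `f`. -/
lemma formInChart_formPullback (α : Form I' M' n) {x₀ : M} {y₀ : M'} {e : E}
    (he : e ∈ (extChartAt I x₀).target)
    (hy : f ((extChartAt I x₀).symm e) ∈ (extChartAt I' y₀).source) :
    formInChart I (formPullback I I' f α) x₀ e =
      (formInChart I' α y₀ (extChartAt I' y₀
        (f ((extChartAt I x₀).symm e)))).compContinuousLinearMap
          (fderiv ℝ (fun z ↦ extChartAt I' y₀ (f ((extChartAt I x₀).symm z))) e) := by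
  have h1 : ContMDiffAt I' 𝓘(ℝ, E') ∞ (extChartAt I' y₀) (f ((extChartAt I x₀).symm e)) :=
    contMDiffAt_extChartAt' (by simpa using hy)
  have h2 := contMDiffAt_extChartAt_symm (I := I) he
  have h3 := (hf ((extChartAt I x₀).symm e)).comp e h2
  rw [formInChart, formPullback, form_eq_formInChart α hy, I.range_eq_univ, mfderivWithin_univ,
    ← mfderiv_eq_fderiv]
  rw [show (fun z ↦ extChartAt I' y₀ (f ((extChartAt I x₀).symm z))) =
    extChartAt I' y₀ ∘ f ∘ (extChartAt I x₀).symm from rfl,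
    mfderiv_comp e (h1.mdifferentiableAt (by simp)) (h3.mdifferentiableAt (by simp)),
    mfderiv_comp e ((hf _).mdifferentiableAt (by simp)) (h2.mdifferentiableAt (by simp))]
  rfl

lemma IsSmoothForm.formPullback [FiniteDimensional ℝ E] [I'.Boundaryless] {α : Form I' M' n}
    (hα : IsSmoothForm I' α) : IsSmoothForm I (formPullback I I' f α) := by
  intro x₀ e he
  let y₀ := f ((extChartAt I x₀).symm e)
  let W := (extChartAt I x₀).target ∩ (fun z ↦ f ((extChartAt I x₀).symm z)) ⁻¹'
    (extChartAt I' y₀).source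
  have hW : IsOpen W := ContinuousOn.isOpen_inter_preimage
    (hf.continuous.comp_continuousOn (continuousOn_extChartAt_symm x₀))
    (isOpen_extChartAt_target x₀) (isOpen_extChartAt_source y₀)
  have heW : e ∈ W := ⟨he, mem_extChartAt_source y₀⟩
  have hg : ContDiffOn ℝ ∞ (fun z ↦ extChartAt I' y₀ (f ((extChartAt I x₀).symm z))) W :=
    fun z hz ↦ (contDiffAt_writtenInCharts hf hz.1 hz.2).contDiffWithinAt
  have h : ContDiffOn ℝ ∞ (formInChart I (KCosymplectic.formPullback I I' f α) x₀) W :=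
    (((hα y₀).comp hg fun z hz ↦ (extChartAt I' y₀).map_source
      hz.2).continuousAlternatingMap_compContinuousLinearMap
        (hg.fderiv_of_isOpen hW (by simp))).congr
      fun z hz ↦ formInChart_formPullback hf α hz.1 hz.2
  exact (h.contDiffAt (hW.mem_nhds heW)).contDiffWithinAt

/-- The exterior derivative of a pullback, computed in any chart of the target. -/
lemma extD_formPullback_eq [I'.Boundaryless] {α : Form I' M' n} (hα : IsSmoothForm I' α)
    {y₀ : M'} {x : M} (hx : f x ∈ (extChartAt I' y₀).source) :
    extD I (formPullback I I' f α) x =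
      (extDeriv (formInChart I' α y₀) (extChartAt I' y₀ (f x))).compContinuousLinearMap
        (mfderiv I' 𝓘(ℝ, E') (extChartAt I' y₀) (f x) ∘L mfderiv I I' f x) := by
  set φ := extChartAt I x
  set ψ := extChartAt I' y₀ with hψ
  have he : φ x ∈ φ.target := mem_extChartAt_target x
  have hinv : φ.symm (φ x) = x := extChartAt_to_inv x
  have hx' : f (φ.symm (φ x)) ∈ ψ.source := by rwa [hinv]
  have hev : formInChart I (formPullback I I' f α) x =ᶠ[𝓝 (φ x)] fun e ↦
      (formInChart I' α y₀ (ψ (f (φ.symm e)))).compContinuousLinearMap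
        (fderiv ℝ (fun z ↦ ψ (f (φ.symm z))) e) := by
    have h1 : φ.target ∈ 𝓝 (φ x) := (isOpen_extChartAt_target x).mem_nhds he
    have h2 : ContinuousAt (fun z ↦ f (φ.symm z)) (φ x) :=
      hf.continuous.continuousAt.comp (continuousAt_extChartAt_symm x)
    filter_upwards [h1, h2.preimage_mem_nhds ((isOpen_extChartAt_source y₀).mem_nhds hx')]
      with e h h'
    exact formInChart_formPullback hf α h h'
  have hg := contDiffAt_writtenInCharts hf he hx'
  have hα' : DifferentiableAt ℝ (formInChart I' α y₀) (ψ (f (φ.symm (φ x)))) :=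
    (contDiffAt_formInChart hα (ψ.map_source hx')).differentiableAt (by simp)
  rw [extD, I.range_eq_univ, extDerivWithin_univ, hev.extDeriv_eq,
    extDeriv_pullback (f := fun z ↦ ψ (f (φ.symm z))) hα' (hg.of_le (m := 2) ENat.LEInfty.out)
      (by simp), hinv]
  have h1 : ContMDiffAt I' 𝓘(ℝ, E') ∞ ψ (f x) := contMDiffAt_extChartAt' (by simpa [hψ] using hx)
  have hev' : (fun z ↦ ψ (f (φ.symm z))) ∘ φ =ᶠ[𝓝 x] ψ ∘ f := by
    filter_upwards [extChartAt_source_mem_nhds (I := I) x] with z hz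
    simp [φ.left_inv hz]
  have hD : fderiv ℝ (fun z ↦ ψ (f (φ.symm z))) (φ x) ∘L mfderiv I 𝓘(ℝ, E) φ x =
      mfderiv I' 𝓘(ℝ, E') ψ (f x) ∘L mfderiv I I' f x := by
    rw [← mfderiv_comp x (h1.mdifferentiableAt (by simp)) ((hf x).mdifferentiableAt (by simp)),
      ← hev'.mfderiv_eq, ← mfderiv_eq_fderiv]
    exact (mfderiv_comp x (hg.contMDiffAt.mdifferentiableAt (by simp))
      ((contMDiffAt_extChartAt (n := ∞)).mdifferentiableAt (by simp))).symm
  exact congrArg (fun L : TangentSpace I x →L[ℝ] E' ↦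
    (extDeriv (formInChart I' α y₀) (ψ (f x))).compContinuousLinearMap L) hD

/-- The exterior derivative commutes with pullbacks. -/
lemma extD_formPullback [I'.Boundaryless] {α : Form I' M' n} (hα : IsSmoothForm I' α) :
    extD I (formPullback I I' f α) = formPullback I I' f (extD I' α) := by
  ext1 x
  rw [extD_formPullback_eq hf hα (mem_extChartAt_source (f x)), formPullback, extD,
    I'.range_eq_univ, extDerivWithin_univ]
  rfl

end Pullback

/-- The exterior derivative can be computed in any chart. -/
lemma extD_eq_of_mem_source [I.Boundaryless] {α : Form I M n} (hα : IsSmoothForm I α) {x₀ x : M}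
    (hx : x ∈ (extChartAt I x₀).source) :
    extD I α x = (extDeriv (formInChart I α x₀) (extChartAt I x₀ x)).compContinuousLinearMap
      (mfderiv I 𝓘(ℝ, E) (extChartAt I x₀) x) := by
  have h := extD_formPullback_eq (f := id) contMDiff_id hα hx
  -- `id^* α = α`, and the formula for the pullback by `id` is the claim
  have hid : formPullback I I id α = α := by
    ext1 x
    simp only [formPullback, mfderiv_id]
    rfl
  rw [hid, mfderiv_id] at h
  exact h

end Manifold

/-! ### Vector fields and Cartan's formula on manifolds -/

section Cartan

variable {E : Type*} [NormedAddCommGroup E] [NormedSpace ℝ E]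
  {H : Type*} [TopologicalSpace H] {I : ModelWithCorners ℝ E H} [I.Boundaryless]
  {M : Type*} [TopologicalSpace M] [ChartedSpace H M] [IsManifold I ∞ M] {n : ℕ}

variable (I) in
/-- The local expression of a vector field in the preferred chart at `x₀`, meaningful on the target
of this chart. -/
noncomputable def fieldInChart (Y : (x : M) → TangentSpace I x) (x₀ : M) : E → E :=
  VectorField.mpullbackWithin 𝓘(ℝ, E) I (extChartAt I x₀).symm Y (Set.range I)

lemma contDiffOn_fieldInChart [FiniteDimensional ℝ E] {Y : (x : M) → TangentSpace I x}
    (hY : ContMDiff I I.tangent ∞ (fun x ↦ (⟨x, Y x⟩ : TangentBundle I M))) (x₀ : M) :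
    ContDiffOn ℝ ∞ (fieldInChart I Y x₀) (extChartAt I x₀).target := by
  have : IsManifold I 1 M := .of_le (n := ∞) (by simp)
  have : CompleteSpace E := FiniteDimensional.complete ℝ E
  intro e he
  have hinv := isInvertible_mfderivWithin_extChartAt_symm (I := I) he
  rw [I.range_eq_univ, mfderivWithin_univ] at hinv
  have h := ContMDiffAt.mpullback_vectorField_preimage (hY ((extChartAt I x₀).symm e))
    (contMDiffAt_extChartAt_symm he) hinv (by simp)
  rw [contMDiffAt_vectorSpace_iff_contDiffAt] at h
  rw [fieldInChart, I.range_eq_univ, VectorField.mpullbackWithin_univ]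
  exact h.contDiffWithinAt

omit [I.Boundaryless] in
lemma mfderivWithin_symm_fieldInChart (Y : (x : M) → TangentSpace I x) {x₀ : M} {e : E}
    (he : e ∈ (extChartAt I x₀).target) :
    mfderivWithin 𝓘(ℝ, E) I (extChartAt I x₀).symm (Set.range I) e
      (fieldInChart (E := E) I Y x₀ e) =
      Y ((extChartAt I x₀).symm e) := by
  have : IsManifold I 1 M := .of_le (n := ∞) (by simp)
  let A : E →L[ℝ] E := mfderivWithin 𝓘(ℝ, E) I (extChartAt I x₀).symm (Set.range I) e
  have h : A.IsInvertible := isInvertible_mfderivWithin_extChartAt_symm (I := I) he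
  exact h.self_apply_inverse (Y ((extChartAt I x₀).symm e))

omit [I.Boundaryless] in
lemma mfderiv_extChartAt_apply_field (Y : (x : M) → TangentSpace I x) {x₀ x : M}
    (hx : x ∈ (extChartAt I x₀).source) :
    mfderiv I 𝓘(ℝ, E) (extChartAt I x₀) x (Y x) = fieldInChart I Y x₀ (extChartAt I x₀ x) := by
  have : IsManifold I 1 M := .of_le (n := ∞) (by simp)
  have h := mfderivWithin_symm_fieldInChart Y ((extChartAt I x₀).map_source hx)
  have h' := DFunLike.congr_fun (mfderiv_extChartAt_comp_mfderivWithin_extChartAt_symm' hx)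
    (fieldInChart I Y x₀ (extChartAt I x₀ x))
  refine Eq.trans ?_ h'
  -- all tangent spaces are `E` by definition: forget the base point, to be able to rewrite it
  let Y' : M → E := Y
  have h2 : Y' ((extChartAt I x₀).symm (extChartAt I x₀ x)) = Y' x := by
    rw [(extChartAt I x₀).left_inv hx]
  exact congrArg (mfderiv I 𝓘(ℝ, E) (extChartAt I x₀) x : E → E) (h2.symm.trans h.symm)

omit [I.Boundaryless] in
lemma formInChart_interiorProduct (Y : (x : M) → TangentSpace I x) (α : Form I M (n + 1))
    {x₀ : M} {e : E} (he : e ∈ (extChartAt I x₀).target) :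
    formInChart I (interiorProduct I Y α) x₀ e =
      (formInChart I α x₀ e).curryLeft (fieldInChart I Y x₀ e) := by
  have h := mfderivWithin_symm_fieldInChart Y he
  ext v
  let α' : M → E [⋀^Fin (n + 1)]→L[ℝ] ℝ := α
  let A : E →L[ℝ] E := mfderivWithin 𝓘(ℝ, E) I (extChartAt I x₀).symm (Set.range I) e
  change α' ((extChartAt I x₀).symm e) (Matrix.vecCons _ (A ∘ v)) =
    α' ((extChartAt I x₀).symm e) (A ∘ Matrix.vecCons (fieldInChart I Y x₀ e) v)
  congr 1
  ext j
  exact Fin.cases h.symm (fun _ ↦ rfl) j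

lemma IsSmoothForm.interiorProduct [FiniteDimensional ℝ E]
    {Y : (x : M) → TangentSpace I x}
    (hY : ContMDiff I I.tangent ∞ (fun x ↦ (⟨x, Y x⟩ : TangentBundle I M)))
    {α : Form I M (n + 1)} (hα : IsSmoothForm I α) :
    IsSmoothForm I (interiorProduct I Y α) := fun x₀ ↦
  ((hα x₀).curryLeft_apply (contDiffOn_fieldInChart hY x₀)).congr
    fun _ he ↦ formInChart_interiorProduct Y α he

/-- **Cartan's formula** `L(Y) α = i(Y) dα + d i(Y) α` on a manifold. -/
lemma lieDerivForm_eq [FiniteDimensional ℝ E] {Y : (x : M) → TangentSpace I x}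
    (hY : ContMDiff I I.tangent ∞ (fun x ↦ (⟨x, Y x⟩ : TangentBundle I M)))
    {α : Form I M (n + 1)} (hα : IsSmoothForm I α) :
    lieDerivForm I Y α = interiorProduct I Y (extD I α) + extD I (interiorProduct I Y α) := by
  ext1 x
  have ht := (isOpen_extChartAt_target (I := I) x).mem_nhds (mem_extChartAt_target x)
  have hev : formInChart I (interiorProduct I Y α) x =ᶠ[𝓝 (extChartAt I x x)] fun e ↦
      (formInChart I α x e).curryLeft (fieldInChart I Y x e) := by
    filter_upwards [ht] with e he
    exact formInChart_interiorProduct Y α he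
  have h1 : DifferentiableAt ℝ (formInChart I α x) (extChartAt I x x) :=
    (contDiffAt_formInChart hα (mem_extChartAt_target x)).differentiableAt (by simp)
  have h2 : DifferentiableAt ℝ (fieldInChart I Y x) (extChartAt I x x) :=
    ((contDiffOn_fieldInChart hY x).contDiffAt ht).differentiableAt (by simp)
  -- Cartan's formula for the local expressions in the preferred chart at `x`
  have h3 := lieDerivWithin_univ_eq h1 h2
  have h4 := mfderiv_extChartAt_apply_field Y (mem_extChartAt_source (I := I) x)
  rw [← hev.extDeriv_eq, ← h4] at h3
  rw [Pi.add_apply, lieDerivForm, I.range_eq_univ]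
  rw [fieldInChart, I.range_eq_univ] at h3
  rw [h3]
  have h5 : interiorProduct I Y (extD I α) x = ((extDeriv (formInChart I α x)
      (extChartAt I x x)).curryLeft (mfderiv I 𝓘(ℝ, E) (extChartAt I x) x (Y
        x))).compContinuousLinearMap (mfderiv I 𝓘(ℝ, E) (extChartAt I x) x) := by
    rw [← extDerivWithin_univ, ← I.range_eq_univ]
    exact ContinuousAlternatingMap.curryLeft_compContinuousLinearMap (E := E) (F := E)
      (extDerivWithin (formInChart I α x) (Set.range I) (extChartAt I x x))
      (mfderiv I 𝓘(ℝ, E) (extChartAt I x) x) (Y x)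
  rw [h5, extD, I.range_eq_univ, extDerivWithin_univ]
  rfl

end Cartan

/-! ### The Poincaré lemma -/

section Poincare

variable {E : Type*} [NormedAddCommGroup E] [NormedSpace ℝ E]
  {H : Type*} [TopologicalSpace H] {I : ModelWithCorners ℝ E H} [I.Boundaryless]
  {M : Type*} [TopologicalSpace M] [ChartedSpace H M] [IsManifold I ∞ M]

/-- A smooth `0`-form is a smooth function: its value at the empty family of vectors, here called
`v`. -/
lemma IsSmoothForm.contMDiff_apply {β : Form I M 0} (hβ : IsSmoothForm I β) (v : Fin 0 → E) :
    ContMDiff I 𝓘(ℝ, ℝ) ∞ (fun x ↦ β x v) := by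
  intro x
  have h1 := (ContinuousAlternatingMap.constOfIsEmptyLIE ℝ E ℝ
    (Fin 0)).symm.contDiff.contDiffAt.comp (extChartAt I x x)
      (contDiffAt_formInChart hβ (mem_extChartAt_target x))
  refine (h1.contMDiffAt.comp x contMDiffAt_extChartAt).congr_of_eventuallyEq ?_
  filter_upwards [extChartAt_source_mem_nhds (I := I) x] with y hy
  have h2 := DFunLike.congr_fun (form_eq_formInChart β hy) v
  refine h2.trans ?_
  exact congrArg (formInChart I β x (extChartAt I x y)) (Subsingleton.elim (α := Fin 0 → E) _ _)

/-- On `0`-forms, the exterior derivative is the differential. -/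
lemma extD_zero_form {β : Form I M 0} (hβ : IsSmoothForm I β) (v : Fin 0 → E) :
    extD I β = differential I (fun x ↦ β x v) := by
  ext1 x
  have hb := hβ.contMDiff_apply v
  have h : formInChart I β x = fun e ↦ ContinuousAlternatingMap.constOfIsEmpty ℝ E (Fin 0)
      (β ((extChartAt I x).symm e) v) := by
    ext e w
    exact congrArg (β ((extChartAt I x).symm e)) (Subsingleton.elim (α := Fin 0 → E) _ _)
  rw [extD, I.range_eq_univ, extDerivWithin_univ, h, extDeriv_constOfIsEmpty]
  have hs : MDifferentiableAt 𝓘(ℝ, E) 𝓘(ℝ, ℝ) (fun e ↦ β ((extChartAt I x).symm e) v)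
      (extChartAt I x x) :=
    ((hb _).comp _ (contMDiffAt_extChartAt_symm (mem_extChartAt_target x))).mdifferentiableAt
      (by simp)
  have hev : (fun e ↦ β ((extChartAt I x).symm e) v) ∘ extChartAt I x =ᶠ[𝓝 x]
      fun x ↦ β x v := by
    filter_upwards [extChartAt_source_mem_nhds (I := I) x] with y hy
    exact congrArg (fun x ↦ β x v : M → ℝ) ((extChartAt I x).left_inv hy)
  have hD : fderiv ℝ (fun e ↦ β ((extChartAt I x).symm e) v) (extChartAt I x x) ∘L
      mfderiv I 𝓘(ℝ, E) (extChartAt I x) x = mfderiv I 𝓘(ℝ, ℝ) (fun x ↦ β x v) x := by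
    rw [← hev.mfderiv_eq, ← mfderiv_eq_fderiv]
    exact (mfderiv_comp x hs
      ((contMDiffAt_extChartAt (n := ∞)).mdifferentiableAt (by simp))).symm
  ext w
  exact DFunLike.congr_fun hD (w 0)

/-- The expression in a chart of a closed form is closed. -/
lemma extDeriv_formInChart_eq_zero {n : ℕ} {β : Form I M n} (hβ : IsSmoothForm I β)
    (hd : extD I β = 0) {x₀ : M} {e : E} (he : e ∈ (extChartAt I x₀).target) :
    extDeriv (formInChart I β x₀) e = 0 := by
  have : IsManifold I 1 M := .of_le (n := ∞) (by simp)
  have h := extD_eq_of_mem_source hβ ((extChartAt I x₀).map_target he)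
  rw [hd, (extChartAt I x₀).right_inv he] at h
  have hA := mfderiv_extChartAt_comp_mfderivWithin_extChartAt_symm he
  let A : E →L[ℝ] E := mfderivWithin 𝓘(ℝ, E) I (extChartAt I x₀).symm (Set.range I) e
  ext v
  refine Eq.trans ?_ (DFunLike.congr_fun h (A ∘ v)).symm
  refine congrArg (extDeriv (formInChart I β x₀) e) ?_
  ext i
  exact (DFunLike.congr_fun hA (v i)).symm

/-- The **Poincaré lemma** for `1`-forms: every point has a neighbourhood, the preimage of a ball in
a chart, on which all closed `1`-forms are exact, and which is connected, so that a function with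
vanishing differential on it is constant. -/
lemma exists_isOpen_forall_exists_isPrimitiveOn (p : M) :
    ∃ U : Set M, IsOpen U ∧ p ∈ U ∧
      (∀ β : Form I M 1, IsSmoothForm I β → extD I β = 0 → ∃ F, IsPrimitiveOn I β U F) ∧
      (∀ f : M → ℝ, ContMDiffOn I 𝓘(ℝ, ℝ) ∞ f U → (∀ x ∈ U, mvfderiv I f x = 0) →
        ∃ c, ∀ x ∈ U, f x = c) := by
  set φ := extChartAt I p with hφ
  obtain ⟨ε, hε, hball⟩ := Metric.isOpen_iff.1 (isOpen_extChartAt_target (I := I) p) (φ p)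
    (mem_extChartAt_target p)
  set B := Metric.ball (φ p) ε with hB
  have hBo : IsOpen B := Metric.isOpen_ball
  have hBc : Convex ℝ B := convex_ball _ _
  have hU : IsOpen (φ.source ∩ φ ⁻¹' B) :=
    (continuousOn_extChartAt p).isOpen_inter_preimage (isOpen_extChartAt_source p) hBo
  have hφU : ContMDiffOn I 𝓘(ℝ, E) ∞ φ (φ.source ∩ φ ⁻¹' B) := fun x hx ↦
    (contMDiffAt_extChartAt' (by simpa [hφ] using hx.1)).contMDiffWithinAt
  have hsymm : ∀ e ∈ B, φ.symm e ∈ φ.source ∩ φ ⁻¹' B := fun e he ↦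
    ⟨φ.map_target (hball he), by rwa [Set.mem_preimage, φ.right_inv (hball he)]⟩
  refine ⟨φ.source ∩ φ ⁻¹' B, hU, ⟨mem_extChartAt_source p, Metric.mem_ball_self hε⟩, ?_, ?_⟩
  · intro β hβ hd
    -- `L` turns `1`-forms into continuous linear functionals
    let L := (ContinuousAlternatingMap.ofSubsingletonLIE (𝕜 := ℝ) (E := E) (F := ℝ)
      (0 : Fin 1)).symm
    have hb : ContDiffOn ℝ ∞ (formInChart I β p) B := (hβ p).mono hball
    have hc : ContDiffOn ℝ ∞ (fun e ↦ L (formInChart I β p e)) B :=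
      L.contDiff.comp_contDiffOn hb
    -- closedness is the symmetry of the derivative
    have hsym : ∀ a ∈ B, ∀ x y, fderiv ℝ (fun e ↦ L (formInChart I β p e)) a x y =
        fderiv ℝ (fun e ↦ L (formInChart I β p e)) a y x := by
      intro a ha x y
      have hba : DifferentiableAt ℝ (formInChart I β p) a :=
        (hb.contDiffAt (hBo.mem_nhds ha)).differentiableAt (by simp)
      have h1 : fderiv ℝ (fun e ↦ L (formInChart I β p e)) a =
          (L : _ →L[ℝ] _) ∘L fderiv ℝ (formInChart I β p) a :=
        L.toContinuousLinearEquiv.comp_fderiv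
      have h2 := DFunLike.congr_fun (extDeriv_formInChart_eq_zero hβ hd (hball ha)) ![x, y]
      rw [extDeriv, ContinuousAlternatingMap.alternatizeUncurryFin_apply] at h2
      have h3 : (0 : Fin 2).removeNth ![x, y] = fun _ ↦ y := by
        ext i; fin_cases i; rfl
      have h4 : (1 : Fin 2).removeNth ![x, y] = fun _ ↦ x := by
        ext i; fin_cases i; rfl
      rw [Fin.sum_univ_two, h3, h4] at h2
      rw [h1]
      change fderiv ℝ (formInChart I β p) a x (fun _ ↦ y) =
        fderiv ℝ (formInChart I β p) a y (fun _ ↦ x)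
      simp at h2
      linarith
    obtain ⟨f, hf⟩ := hBc.exists_forall_hasFDerivAt_of_fderiv_symmetric hBo
      (hc.differentiableOn (by simp)) hsym
    have hfs : ContDiffOn ℝ ∞ f B := by
      rw [contDiffOn_infty_iff_fderivWithin hBo.uniqueDiffOn]
      refine ⟨fun e he ↦ (hf e he).differentiableAt.differentiableWithinAt, hc.congr fun e he ↦ ?_⟩
      rw [fderivWithin_of_isOpen hBo he, (hf e he).fderiv]
    refine ⟨f ∘ φ, hfs.contMDiffOn.comp hφU fun x hx ↦ hx.2, fun x hx ↦ ?_⟩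
    have hD : mfderiv I 𝓘(ℝ, ℝ) (f ∘ φ) x =
        L (formInChart I β p (φ x)) ∘L mfderiv I 𝓘(ℝ, E) φ x := by
      rw [← (hf _ hx.2).fderiv, ← mfderiv_eq_fderiv]
      exact mfderiv_comp x (hf _ hx.2).differentiableAt.mdifferentiableAt
        ((hφU.contMDiffAt (hU.mem_nhds hx)).mdifferentiableAt (by simp))
    rw [form_eq_formInChart β hx.1]
    ext w
    refine Eq.trans ?_ (DFunLike.congr_fun hD (w 0)).symm
    refine congrArg (formInChart I β p (φ x)) ?_
    ext i
    rw [Subsingleton.elim i 0]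
  · intro f hf hdf
    have hs : ∀ e ∈ B, ContMDiffAt 𝓘(ℝ, E) I ∞ φ.symm e := fun e he ↦
      contMDiffAt_extChartAt_symm (hball he)
    have hf' : ∀ x ∈ φ.source ∩ φ ⁻¹' B, ContMDiffAt I 𝓘(ℝ, ℝ) ∞ f x := fun x hx ↦
      hf.contMDiffAt (hU.mem_nhds hx)
    have hg : DifferentiableOn ℝ (f ∘ φ.symm) B := fun e he ↦
      (((hf' _ (hsymm e he)).comp e (hs e he)).contDiffAt.differentiableAt
        (by simp)).differentiableWithinAt
    have hdg : B.EqOn (fderiv ℝ (f ∘ φ.symm)) 0 := by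
      intro e he
      rw [← mfderiv_eq_fderiv, mfderiv_comp e ((hf' _ (hsymm e he)).mdifferentiableAt (by simp))
        ((hs e he).mdifferentiableAt (by simp))]
      have h0 : mfderiv I 𝓘(ℝ, ℝ) f (φ.symm e) = 0 := hdf _ (hsymm e he)
      rw [h0]
      ext w
      rfl
    obtain ⟨c, hc⟩ := hBo.exists_is_const_of_fderiv_eq_zero hBc.isPreconnected hg hdg
    refine ⟨c, fun x hx ↦ ?_⟩
    rw [← hc _ hx.2, Function.comp_apply, φ.left_inv hx.1]

end Poincare

/-! ### Invariant closed forms -/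

section Noether

variable {E : Type*} [NormedAddCommGroup E] [NormedSpace ℝ E] [FiniteDimensional ℝ E]
  {H : Type*} [TopologicalSpace H] {I : ModelWithCorners ℝ E H} [I.Boundaryless]
  {M : Type*} [TopologicalSpace M] [ChartedSpace H M] [IsManifold I ∞ M]

omit [FiniteDimensional ℝ E] [I.Boundaryless] [IsManifold I ∞ M] in
lemma differential_apply_eq_iff {f g : M → ℝ} {x : M} :
    differential I f x = differential I g x ↔ mvfderiv I f x = mvfderiv I g x :=
  (ContinuousAlternatingMap.ofSubsingleton ℝ (TangentSpace I x) ℝ (0 : Fin 1)).injective.eq_iff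

omit [FiniteDimensional ℝ E] [I.Boundaryless] [IsManifold I ∞ M] in
lemma differential_sub_apply {f g : M → ℝ} {x : M} (hf : MDifferentiableAt I 𝓘(ℝ, ℝ) f x)
    (hg : MDifferentiableAt I 𝓘(ℝ, ℝ) g x) :
    differential I (f - g) x = differential I f x - differential I g x := by
  rw [differential, mvfderiv_sub hf hg]
  rfl

lemma contMDiff_contract {Y : (x : M) → TangentSpace I x}
    (hY : ContMDiff I I.tangent ∞ (fun x ↦ (⟨x, Y x⟩ : TangentBundle I M)))
    {θ : Form I M 1} (hθ : IsSmoothForm I θ) : ContMDiff I 𝓘(ℝ, ℝ) ∞ (contract I Y θ) :=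
  (IsSmoothForm.interiorProduct hY hθ).contMDiff_apply ![]

/-- Cartan's formula for `1`-forms. -/
lemma lieDerivForm_one_form {Y : (x : M) → TangentSpace I x}
    (hY : ContMDiff I I.tangent ∞ (fun x ↦ (⟨x, Y x⟩ : TangentBundle I M)))
    {θ : Form I M 1} (hθ : IsSmoothForm I θ) :
    lieDerivForm I Y θ = interiorProduct I Y (extD I θ) + differential I (contract I Y θ) := by
  rw [lieDerivForm_eq hY hθ, extD_zero_form (IsSmoothForm.interiorProduct hY hθ) ![]]
  rfl

/-- If a field preserves a closed form, then its contraction with the form is closed. -/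
lemma extD_interiorProduct_eq_zero {n : ℕ} {Y : (x : M) → TangentSpace I x}
    (hY : ContMDiff I I.tangent ∞ (fun x ↦ (⟨x, Y x⟩ : TangentBundle I M)))
    {α : Form I M (n + 1)} (hα : IsSmoothForm I α) (hd : extD I α = 0)
    (hL : lieDerivForm I Y α = 0) : extD I (interiorProduct I Y α) = 0 := by
  have h := lieDerivForm_eq hY hα
  rw [hL, hd] at h
  have h0 : interiorProduct I Y (0 : Form I M (n + 2)) = 0 := rfl
  rw [h0, zero_add] at h
  exact h.symm

omit [FiniteDimensional ℝ E] [I.Boundaryless] [IsManifold I ∞ M] in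
lemma interiorProduct_neg {n : ℕ} (Y : (x : M) → TangentSpace I x) (α : Form I M (n + 1)) :
    interiorProduct I Y (-α) = -interiorProduct I Y α := rfl

lemma KSymplecticStructure.isSmoothForm_omega {k n : ℕ}
    (S : KSymplecticStructure I M k n) (A : Fin k) :
    IsSmoothForm (phaseModel I k) (S.omega A) :=
  IsSmoothForm.formPullback contMDiff_snd (S.smooth A)

omit [FiniteDimensional ℝ E] in
lemma KSymplecticStructure.extD_omega {k n : ℕ}
    (S : KSymplecticStructure I M k n) (A : Fin k) :
    extD (phaseModel I k) (S.omega A) = 0 := by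
  rw [KSymplecticStructure.omega, extD_formPullback contMDiff_snd (S.smooth A), S.closed A]
  rfl

end Noether

end KCosymplectic

theorem mainTheorem2
    {E : Type*} [NormedAddCommGroup E] [NormedSpace ℝ E] [FiniteDimensional ℝ E]
    {H : Type*} [TopologicalSpace H] (I : ModelWithCorners ℝ E H) [I.Boundaryless]
    (M : Type*) [TopologicalSpace M] [ChartedSpace H M] [IsManifold I ∞ M]
    (k n : ℕ) (S : KSymplecticStructure I M k n)
    (h : Phase M k → ℝ) (hh : ContMDiff (phaseModel I k) 𝓘(ℝ, ℝ) ∞ h)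
    (Y : (x : Phase M k) → TangentSpace (phaseModel I k) x)
    (hY : IsInfinitesimalNoetherSymmetry S h Y) (p : Phase M k) :
    ∃ U : Set (Phase M k), IsOpen U ∧ p ∈ U ∧
      -- the functions `F` with `i(Y) ω = d F`: existence, and uniqueness up to constants
      (∀ A : Fin k,
        (∃ F : Phase M k → ℝ,
          IsPrimitiveOn (phaseModel I k) (interiorProduct (phaseModel I k) Y (S.omega A)) U F) ∧
        (∀ F F' : Phase M k → ℝ,
          IsPrimitiveOn (phaseModel I k) (interiorProduct (phaseModel I k) Y (S.omega A)) U F →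
          IsPrimitiveOn (phaseModel I k) (interiorProduct (phaseModel I k) Y (S.omega A)) U F' →
          ∃ c : ℝ, ∀ x ∈ U, F' x = F x + c)) ∧
      -- the functions `ζ` with `L(Y) θ = d ζ`, for all potentials `θ`, that is, `ω = - d θ`
      (∀ θ : Fin k → Form (phaseModel I k) (Phase M k) 1,
        (∀ A, IsSmoothForm (phaseModel I k) (θ A)) →
        (∀ A, S.omega A = -extD (phaseModel I k) (θ A)) →
        ∀ A : Fin k,
          (∃ ζ : Phase M k → ℝ,
            IsPrimitiveOn (phaseModel I k) (lieDerivForm (phaseModel I k) Y (θ A)) U ζ) ∧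
          (∀ F ζ : Phase M k → ℝ,
            IsPrimitiveOn (phaseModel I k) (interiorProduct (phaseModel I k) Y (S.omega A)) U F →
            IsPrimitiveOn (phaseModel I k) (lieDerivForm (phaseModel I k) Y (θ A)) U ζ →
            ∃ c : ℝ, ∀ x ∈ U, F x = contract (phaseModel I k) Y (θ A) x - ζ x + c)) := by
  obtain ⟨U, hU, hp, hprim, hconst⟩ :=
    exists_isOpen_forall_exists_isPrimitiveOn (I := phaseModel I k) p
  -- on `U`, functions with the same differential differ by a constant
  have huniq : ∀ f g : Phase M k → ℝ, ContMDiffOn (phaseModel I k) 𝓘(ℝ, ℝ) ∞ f U →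
      ContMDiffOn (phaseModel I k) 𝓘(ℝ, ℝ) ∞ g U →
      (∀ x ∈ U, differential (phaseModel I k) f x = differential (phaseModel I k) g x) →
      ∃ c : ℝ, ∀ x ∈ U, f x = g x + c := by
    intro f g hf hg hfg
    obtain ⟨c, hc⟩ := hconst (f - g) (hf.sub hg) fun x hx ↦ by
      rw [mvfderiv_sub ((hf.contMDiffAt (hU.mem_nhds hx)).mdifferentiableAt (by simp))
        ((hg.contMDiffAt (hU.mem_nhds hx)).mdifferentiableAt (by simp)),
        differential_apply_eq_iff.1 (hfg x hx), sub_self]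
    exact ⟨c, fun x hx ↦ by rw [← hc x hx, Pi.sub_apply, add_sub_cancel]⟩
  have hF (A : Fin k) : ∃ F : Phase M k → ℝ, IsPrimitiveOn (phaseModel I k)
      (interiorProduct (phaseModel I k) Y (S.omega A)) U F :=
    hprim _ (IsSmoothForm.interiorProduct hY.smooth (S.isSmoothForm_omega A))
      (extD_interiorProduct_eq_zero hY.smooth (S.isSmoothForm_omega A) (S.extD_omega A)
        (hY.lieDeriv_omega A))
  refine ⟨U, hU, hp, fun A ↦ ⟨hF A, fun F F' h1 h2 ↦ huniq F' F h2.1 h1.1 fun x hx ↦ ?_⟩,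
    fun θ hθ hω A ↦ ?_⟩
  · rw [← h1.2 x hx, ← h2.2 x hx]
  have hcs := contMDiff_contract hY.smooth (hθ A)
  -- Cartan's formula reads `L(Y) θ = d (i(Y) θ) - i(Y) ω`
  have hL : lieDerivForm (phaseModel I k) Y (θ A) =
      differential (phaseModel I k) (contract (phaseModel I k) Y (θ A)) -
        interiorProduct (phaseModel I k) Y (S.omega A) := by
    rw [lieDerivForm_one_form hY.smooth (hθ A), hω A, interiorProduct_neg, sub_neg_eq_add, add_comm]
  have hsub : ∀ g : Phase M k → ℝ, ContMDiffOn (phaseModel I k) 𝓘(ℝ, ℝ) ∞ g U → ∀ x ∈ U,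
      differential (phaseModel I k) (contract (phaseModel I k) Y (θ A) - g) x =
        differential (phaseModel I k) (contract (phaseModel I k) Y (θ A)) x -
          differential (phaseModel I k) g x := fun g hg x hx ↦
    differential_sub_apply ((hcs x).mdifferentiableAt (by simp))
      ((hg.contMDiffAt (hU.mem_nhds hx)).mdifferentiableAt (by simp))
  refine ⟨?_, fun F ζ h1 h2 ↦ huniq F (contract (phaseModel I k) Y (θ A) - ζ) h1.1
    (hcs.contMDiffOn.sub h2.1) fun x hx ↦ ?_⟩
  · obtain ⟨F, h1⟩ := hF A
    refine ⟨contract (phaseModel I k) Y (θ A) - F, hcs.contMDiffOn.sub h1.1, fun x hx ↦ ?_⟩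
    rw [hsub F h1.1 x hx, hL, Pi.sub_apply, h1.2 x hx]
  · rw [hsub ζ h2.1 x hx, ← h2.2 x hx, hL, Pi.sub_apply, sub_sub_cancel, h1.2 x hx]
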